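/- A signed simple graph $\Sigma=(\Gamma,\sigma)$ is a finite simple graph $\Gamma$ with a signature $\sigma:E(\Gamma)\to\{+1,-1\}$; let $\Delta$ be the maximum degree of $\Gamma$. Let $M_n=\{\pm1,\ldots,\pm k\}$ if $n=2k$ and $M_n=\{0,\pm1,\ldots,\pm k\}$ if $n=2k+1$. A proper $n$-colouring of $\Sigma$ assigns to each incidence $(v,e)$ (a vertex $v$ and an edge $e$ with endpoint $v$) a colour $\gamma(v,e)\in M_n$ such that $\gamma(v,e)=-\sigma(e)\gamma(w,e)$ for each edge $e$ with endpoints $v\ne w$, and $\gamma(v,e)\neq\gamma(v,f)$ for any two distinct edges $e,f$ with common endpoint $v$. It is zero-free if it does not use the colour $0$. Let $\chi'(\Sigma)$ be the smallest $n$ such that $\Sigma$ has a proper $n$-colouring. Theorem (Zero-free Signed Vizing's Theorem). Let $\Sigma$ be a signed simple graph with maximum degree $\Delta$. If $\Delta$ is odd, then $\Delta\le\chi'(\Sigma)\le\Delta+1$, and $\Sigma$ has a zero-free proper $(\Delta+1)$-colouring. If $\Delta$ is even, then $\Delta\le\chi'(\Sigma)\le\Delta+2$, and $\Sigma$ has a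 zero-free proper $(\Delta+2)$-colouring. -/

import Mathlib

/-- A signed (simple) graph `Σ = (Γ, σ)`: a simple graph together with a sign `±1` on each edge. -/
structure SignedGraph (V : Type*) where
  /-- the underlying graph -/
  graph : SimpleGraph V
  /-- the signature -/
  sign : graph.edgeSet → ℤˣ

/-- The signed colour set `M n`: it is `{±1, …, ±k}` if `n = 2k` and `{0, ±1, …, ±k}` if
`n = 2k + 1`. -/
def signedColors (n : ℕ) : Set ℤ :=
  {a | |a| ≤ ((n / 2 : ℕ) : ℤ) ∧ (a = 0 → Odd n)}

namespace SignedGraph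

variable {V : Type*}

/-- An incidence `(v, e)` of a signed graph: a vertex `v` and an edge `e` with endpoint `v`. -/
@[ext]
structure Incidence (S : SignedGraph V) where
  vertex : V
  edge : S.graph.edgeSet
  mem : vertex ∈ (edge : Sym2 V)

/-- An `n`-edge colouring: an assignment of colours of `M n` to the incidences such that
`γ (v, e) = - σ e * γ (w, e)` for every edge `e` with (distinct) endpoints `v` and `w`. -/
structure Coloring (S : SignedGraph V) (n : ℕ) where
  color : S.Incidence → ℤ
  color_mem : ∀ i, color i ∈ signedColors n
  compat : ∀ i j : S.Incidence, i.edge = j.edge → i.vertex ≠ j.vertex →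
    color i = -(S.sign i.edge : ℤ) * color j

/-- A colouring is proper if distinct edges at a common vertex have distinct colours there. -/
def Coloring.IsProper {S : SignedGraph V} {n : ℕ} (γ : S.Coloring n) : Prop :=
  ∀ i j : S.Incidence, i.vertex = j.vertex → i.edge ≠ j.edge → γ.color i ≠ γ.color j

/-- A colouring is zero-free if it omits the colour `0`. -/
def Coloring.IsZeroFree {S : SignedGraph V} {n : ℕ} (γ : S.Coloring n) : Prop :=
  ∀ i : S.Incidence, γ.color i ≠ 0

/-- The chromatic index `χ'`: the least `n` such that there is a proper `n`-edge colouring. -/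
noncomputable def chromaticIndex (S : SignedGraph V) : ℕ :=
  sInf {n | ∃ γ : S.Coloring n, γ.IsProper}

end SignedGraph

/-!
If every degree of a signed graph is less than `2 * k`, then the graph has a proper colouring with
the `2 * k` colours `±1, …, ±k`. For odd `Δ` this is applied with `2 * k = Δ + 1`, for even `Δ`
with `2 * k = Δ + 2`; the bound `Δ ≤ χ'` is immediate, since the colours at a vertex are distinct.

The colouring is found by improving partial colourings, following Vizing. Let `vy` be an uncoloured
edge. Every vertex misses a colour, and `v` misses two colours `a₁ ≠ a₂`. A neighbour `x` of `v`
*offers* the colour `t` to `v` if giving `vx` the colour `t` at `v` would create no conflict at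
`x`. A fan starts with `y`, and each of its vertices offers the colour of the next edge; if the
last vertex offers a colour missing at `v`, then shifting the colours along the fan colours `vy`
too (`improvable_of_offers`).

A signed Kempe change interchanges `a` with `b` and `-a` with `-b`, where `a ≠ ±b`. It takes place
on the components of a graph of maximum degree two whose vertices are the nodes `(u, s)` with
`s = ±1`, standing for the colours `s a` and `s b` at `u`. A component has at most two ends, that
is, nodes at which one of the two colours is missing (`not_reachable_of_isEnd`). Unlike in the
unsigned case, a component may meet `v` in the node `(v, -1)` as well as in `(v, 1)`, which can
disturb the fan. Three steps deal with this.

* If `a` and `-a` are missing at `v`, both nodes of `v` are ends, and the classical argument works: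
  when the fan is disturbed, its part up to the disturbed edge can be shifted instead
  (`improvable_of_misses_neg`).
* If a vertex of the fan offers `±a₁` or `±a₂`, the only bad case is that the first such vertex
  offers, say, `-a₂`. The two nodes of `v` and that vertex are then three ends for the pair
  `a₁, -a₂`. Either the change at the vertex makes it offer `a₁`, or a change at `v` makes both
  `a₂` and `-a₂` missing there (`improvable_of_offers_unit_mul`).
* In general, take a maximal fan whose edges at `v` have colours of distinct absolute values. Its
  last vertex offers `±b`, where `b` is a colour of the fan. A change of `a₁, b` at the vertex that
  offers `b` within the fan, or else at the last vertex, leaves the fan intact, as `-b` does not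
  occur in it, and leads to one of the cases above (`IsPartialColoring.improvable`).
-/

/-! ### Graphs of maximum degree two -/

/-- Three distinct vertices of degree at most one never share a component of a graph of maximum
degree two, because a component with `n` vertices has degree sum at least `2 * (n - 1)`. -/
theorem SimpleGraph.not_reachable_of_degree_le_one {W : Type*} [Fintype W] (H : SimpleGraph W)
    [DecidableRel H.Adj] (hdeg : ∀ n, H.degree n ≤ 2) {n₁ n₂ n₃ : W} (h₁₂ : n₁ ≠ n₂)
    (h₁₃ : n₁ ≠ n₃) (h₂₃ : n₂ ≠ n₃) (h₁ : H.degree n₁ ≤ 1) (h₂ : H.degree n₂ ≤ 1)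
    (h₃ : H.degree n₃ ≤ 1) (h : H.Reachable n₁ n₂) : ¬ H.Reachable n₁ n₃ := by
  classical
  intro h'
  let C := H.connectedComponentMk n₁
  have hconn := C.connected_toSimpleGraph
  have hcard := hconn.card_vert_le_card_edgeSet_add_one
  have hle : ∀ x : C, C.toSimpleGraph.degree x ≤ H.degree x.1 := by
    intro x
    rw [← SimpleGraph.card_neighborFinset_eq_degree, ← SimpleGraph.card_neighborFinset_eq_degree]
    refine Finset.card_le_card_of_injOn Subtype.val ?_ (Subtype.val_injective.injOn)
    intro y hy
    have hy' : C.toSimpleGraph.Adj x y := by simpa using hy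
    exact (H.mem_neighborFinset _ _).2 (C.toSimpleGraph_hom.map_rel hy')
  have hsum := C.toSimpleGraph.sum_degrees_eq_twice_card_edges
  let T : Finset C := {⟨n₁, rfl⟩, ⟨n₂, SimpleGraph.ConnectedComponent.sound h.symm⟩,
    ⟨n₃, SimpleGraph.ConnectedComponent.sound h'.symm⟩}
  have hT : T.card = 3 := Finset.card_eq_three.2 ⟨_, _, _, fun e => h₁₂ (congrArg Subtype.val e),
    fun e => h₁₃ (congrArg Subtype.val e), fun e => h₂₃ (congrArg Subtype.val e), rfl⟩
  have hbound : ∀ x : C, C.toSimpleGraph.degree x + (if x ∈ T then 1 else 0) ≤ 2 := by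
    intro x
    have hx := hle x
    by_cases hxT : x ∈ T
    · have : H.degree x.1 ≤ 1 := by
        simp only [T, Finset.mem_insert, Finset.mem_singleton] at hxT
        rcases hxT with rfl | rfl | rfl <;> assumption
      simp only [hxT, if_true]; omega
    · simp only [hxT, if_false]; exact hx.trans (hdeg _)
  have htotal := Finset.sum_le_sum fun x (_ : x ∈ (Finset.univ : Finset C)) => hbound x
  rw [Finset.sum_add_distrib, hsum] at htotal
  simp only [Finset.sum_ite_mem, Finset.univ_inter, Finset.sum_const, smul_eq_mul, mul_one,
    Finset.card_univ, hT] at htotal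
  rw [Nat.card_eq_fintype_card, Nat.card_eq_fintype_card, ← SimpleGraph.edgeFinset_card] at hcard
  omega

namespace SignedVizing

variable {V : Type*}

/-! ### Partial edge colourings -/

/-- A proper partial edge colouring, with colours `±1, …, ±k`, of the graph `G` with signs `σ`:
`c u w` is the colour of the incidence of `u` with the edge `uw`, and `0` stands for an uncoloured
edge (or for a pair of vertices that are not adjacent). -/
structure IsPartialColoring (G : SimpleGraph V) (σ : V → V → ℤˣ) (k : ℕ) (c : V → V → ℤ) :
    Prop where
  adj : ∀ {u w}, c u w ≠ 0 → G.Adj u w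
  compat : ∀ u w, c w u = ((-σ u w : ℤˣ) : ℤ) * c u w
  bound : ∀ u w, |c u w| ≤ k
  proper : ∀ {u w w'}, c u w ≠ 0 → c u w = c u w' → w = w'

/-- The colour `t` does not occur at the vertex `u`. -/
def Misses (c : V → V → ℤ) (u : V) (t : ℤ) : Prop := ∀ w, c u w ≠ t

/-- The number of coloured incidences. -/
noncomputable def weight [Fintype V] (c : V → V → ℤ) : ℕ := by
  classical exact (Finset.univ.filter fun p : V × V => c p.1 p.2 ≠ 0).card

/-- Some partial colouring colours more edges than `c` does. -/
def Improvable [Fintype V] (G : SimpleGraph V) (σ : V → V → ℤˣ) (k : ℕ) (c : V → V → ℤ) : Prop :=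
  ∃ c', IsPartialColoring G σ k c' ∧ weight c < weight c'

theorem int_unit_mul_self (s : ℤˣ) (t : ℤ) : (s : ℤ) * ((s : ℤ) * t) = t := by
  rcases Int.units_eq_one_or s with rfl | rfl <;> simp

theorem int_unit_mul_eq_zero {s : ℤˣ} {t : ℤ} : (s : ℤ) * t = 0 ↔ t = 0 := by
  rcases Int.units_eq_one_or s with rfl | rfl <;> simp

theorem abs_int_unit_mul (s : ℤˣ) (t : ℤ) : |(s : ℤ) * t| = |t| := by
  rcases Int.units_eq_one_or s with rfl | rfl <;> simp

section Recolor

/-! ### Recolouring one edge -/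

open Classical in
/-- Give the edge `vy` the colour `t` at `v`, hence the colour `-σ(vy) t` at `y`; the value `t = 0`
uncolours the edge. -/
noncomputable def setColor (σ : V → V → ℤˣ) (c : V → V → ℤ) (v y : V) (t : ℤ) : V → V → ℤ :=
  fun u w => if u = v ∧ w = y then t else if u = y ∧ w = v then ((-σ v y : ℤˣ) : ℤ) * t else c u w

variable {G : SimpleGraph V} {σ : V → V → ℤˣ} {k : ℕ} {c : V → V → ℤ}

theorem setColor_self (v y : V) (t : ℤ) : setColor σ c v y t v y = t := by simp [setColor]

theorem setColor_of_ne {v y u w : V} (t : ℤ) (h : ¬ (u = v ∧ w = y)) (h' : ¬ (u = y ∧ w = v)) :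
    setColor σ c v y t u w = c u w := by simp [setColor, h, h']

theorem setColor_swap {v y : V} (hvy : v ≠ y) (t : ℤ) :
    setColor σ c v y t y v = ((-σ v y : ℤˣ) : ℤ) * t := by simp [setColor, hvy.symm]

theorem IsPartialColoring.eq_zero_comm (h : IsPartialColoring G σ k c) {u w : V} :
    c u w = 0 ↔ c w u = 0 := by
  rw [h.compat u w, int_unit_mul_eq_zero]

theorem IsPartialColoring.uncolor (h : IsPartialColoring G σ k c) {v y : V} :
    IsPartialColoring G σ k (setColor σ c v y 0) := by
  have key : ∀ u w, setColor σ c v y 0 u w ≠ 0 →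
      setColor σ c v y 0 u w = c u w ∧ c u w ≠ 0 := by
    intro u w
    unfold setColor
    split_ifs <;> simp
  refine ⟨fun h0 => h.adj (key _ _ h0).2, fun u w => ?_, fun u w => ?_, fun {u w w'} h0 h1 => ?_⟩
  · have hw := h.compat u w
    unfold setColor
    split_ifs <;> first | exact hw | (exfalso; tauto) | simp
  · by_cases h0 : setColor σ c v y 0 u w = 0
    · simp [h0]
    · rw [(key _ _ h0).1]; exact h.bound _ _
  · have h2 := key _ _ h0
    have h3 := key _ _ (h1 ▸ h0)
    exact h.proper h2.2 (h2.1 ▸ h3.1 ▸ h1)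

/-- An uncoloured edge may receive any colour that is missing at both of its ends. -/
theorem IsPartialColoring.color_edge (h : IsPartialColoring G σ k c) (hσ : ∀ u w, σ u w = σ w u)
    {v y : V} (hvy : G.Adj v y)
    {t : ℤ} (ht : |t| ≤ k) (hv : Misses c v t) (hy : Misses c y (((-σ v y : ℤˣ) : ℤ) * t)) :
    IsPartialColoring G σ k (setColor σ c v y t) := by
  have hne := hvy.ne
  refine ⟨fun {u w} h0 => ?_, fun u w => ?_, fun u w => ?_, fun {u w w'} h0 h1 => ?_⟩
  · by_cases h1 : u = v ∧ w = y
    · rw [h1.1, h1.2]; exact hvy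
    by_cases h2 : u = y ∧ w = v
    · rw [h2.1, h2.2]; exact hvy.symm
    rw [setColor_of_ne t h1 h2] at h0
    exact h.adj h0
  · by_cases h1 : u = v ∧ w = y
    · rw [h1.1, h1.2, setColor_self, setColor_swap hne]
    by_cases h2 : u = y ∧ w = v
    · rw [h2.1, h2.2, setColor_self, setColor_swap hne, hσ y v, int_unit_mul_self]
    rw [setColor_of_ne t h1 h2, setColor_of_ne t (by tauto) (by tauto)]
    exact h.compat u w
  · unfold setColor
    split_ifs
    · exact ht
    · rw [abs_int_unit_mul]; exact ht
    · exact h.bound u w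
  · have hval : ∀ u w, setColor σ c v y t u w = c u w ∨
        (u = v ∧ w = y ∧ setColor σ c v y t u w = t) ∨
        (u = y ∧ w = v ∧ setColor σ c v y t u w = ((-σ v y : ℤˣ) : ℤ) * t) := by
      intro u w
      unfold setColor
      split_ifs <;> simp_all
    rcases hval u w with e | ⟨rfl, rfl, e⟩ | ⟨rfl, rfl, e⟩ <;>
      rcases hval u w' with e' | ⟨e1, rfl, e'⟩ | ⟨e1, rfl, e'⟩
    · rw [e] at h0
      rw [e, e'] at h1
      exact h.proper h0 h1
    · rw [e, e', e1] at h1; exact absurd h1 (hv w)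
    · rw [e, e', e1] at h1; exact absurd h1 (hy w)
    · rw [e, e'] at h1; exact absurd h1.symm (hv w')
    · rfl
    · exact absurd e1 hne
    · rw [e, e'] at h1; exact absurd h1.symm (hy w')
    · exact absurd e1.symm hne
    · rfl

theorem weight_setColor_zero [Fintype V] {v y : V} (hvy : v ≠ y) (h1 : c v y ≠ 0) (h2 : c y v ≠ 0) :
    weight (setColor σ c v y 0) + 2 = weight c := by
  classical
  unfold weight
  have : (Finset.univ.filter fun p : V × V => c p.1 p.2 ≠ 0) =
      insert (v, y) (insert (y, v)
        (Finset.univ.filter fun p : V × V => setColor σ c v y 0 p.1 p.2 ≠ 0)) := by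
    ext ⟨u, w⟩
    rw [Finset.mem_insert, Finset.mem_insert, Finset.mem_filter, Finset.mem_filter]
    simp only [setColor, Finset.mem_univ, true_and, Prod.mk.injEq]
    split_ifs <;> simp_all
    tauto
  convert (congrArg Finset.card this).symm using 1
  rw [Finset.card_insert_of_notMem, Finset.card_insert_of_notMem]
  · simp [setColor, hvy.symm]
  · simp [setColor, hvy]

theorem weight_setColor [Fintype V] {v y : V} (hvy : v ≠ y) (h1 : c v y = 0) (h2 : c y v = 0)
    {t : ℤ} (ht : t ≠ 0) : weight (setColor σ c v y t) = weight c + 2 := by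
  have h3 : setColor σ (setColor σ c v y t) v y 0 = c := by
    funext u w
    unfold setColor
    split_ifs <;> simp_all
  have := weight_setColor_zero (σ := σ) (c := setColor σ c v y t) hvy
    (by rwa [setColor_self]) (by rwa [setColor_swap hvy, Ne, int_unit_mul_eq_zero])
  rw [h3] at this
  exact this.symm

end Recolor

section Kempe

variable {G : SimpleGraph V} {σ : V → V → ℤˣ} {k : ℕ} {c : V → V → ℤ}

/-! ### Signed Kempe changes -/

open Classical in
/-- The Kempe change at the vertex `u`. A node `(u, s)` stands for the colour pair `{s a, s b}` at
`u`; the colours of the pair are interchanged if the node belongs to `N`. -/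
noncomputable def exchange (a b : ℤ) (N : Set (V × ℤˣ)) (u : V) (t : ℤ) : ℤ :=
  if t = a ∧ (u, 1) ∈ N then b else if t = b ∧ (u, 1) ∈ N then a
  else if t = -a ∧ (u, -1) ∈ N then -b else if t = -b ∧ (u, -1) ∈ N then -a else t

/-- The colour `t` is none of `±a`, `±b`. -/
def Avoids (a b t : ℤ) : Prop := |t| ≠ |a| ∧ |t| ≠ |b|

/-- Two nonzero colours `a` and `b` with `a ≠ ±b`, so that `±a`, `±b` are four colours. -/
structure KempePair (k : ℕ) (a b : ℤ) : Prop where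
  left_ne : a ≠ 0
  right_ne : b ≠ 0
  left_le : |a| ≤ k
  right_le : |b| ≤ k
  abs_ne : |a| ≠ |b|

theorem exists_unit_mul_of_abs_eq {t a : ℤ} (h : |t| = |a|) : ∃ s : ℤˣ, t = s * a := by
  rcases abs_eq_abs.1 h with rfl | rfl
  · exact ⟨1, by simp⟩
  · exact ⟨-1, by simp⟩

theorem avoids_or (a b t : ℤ) :
    (∃ s : ℤˣ, t = s * a) ∨ (∃ s : ℤˣ, t = s * b) ∨ Avoids a b t := by
  by_cases h1 : |t| = |a|
  · exact Or.inl (exists_unit_mul_of_abs_eq h1)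
  by_cases h2 : |t| = |b|
  · exact Or.inr (Or.inl (exists_unit_mul_of_abs_eq h2))
  · exact Or.inr (Or.inr ⟨h1, h2⟩)

theorem Avoids.unit_mul {a b t : ℤ} (h : Avoids a b t) (s : ℤˣ) : Avoids a b (s * t) := by
  rwa [Avoids, abs_int_unit_mul]

variable {a b : ℤ} {N : Set (V × ℤˣ)}

theorem KempePair.ne (h : KempePair k a b) : a ≠ b ∧ a ≠ -b := by
  refine ⟨fun e => h.abs_ne (by rw [e]), fun e => h.abs_ne (by rw [e, abs_neg])⟩

theorem exchange_left (h : KempePair k a b) {u : V} {s : ℤˣ} (hu : (u, s) ∈ N) :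
    exchange a b N u (s * a) = s * b := by
  obtain ⟨h1, h2⟩ := h.ne
  have h3 := h.left_ne
  have h4 := h.right_ne
  rcases Int.units_eq_one_or s with rfl | rfl
  · simp [exchange, hu]
  · have e1 : ¬ (-a = a) := by omega
    have e2 : ¬ (-a = b) := by omega
    simp [exchange, hu, e1, e2]

theorem exchange_right (h : KempePair k a b) {u : V} {s : ℤˣ} (hu : (u, s) ∈ N) :
    exchange a b N u (s * b) = s * a := by
  obtain ⟨h1, h2⟩ := h.ne
  have h3 := h.left_ne
  have h4 := h.right_ne
  rcases Int.units_eq_one_or s with rfl | rfl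
  · have e1 : ¬ (b = a) := by omega
    simp [exchange, hu, e1]
  · have e1 : ¬ (-b = b) := by omega
    have e2 : ¬ (-b = a) := by omega
    have e3 : ¬ (b = a) := by omega
    simp [exchange, hu, e1, e2, e3]

theorem exchange_left_of_notMem (h : KempePair k a b) {u : V} {s : ℤˣ} (hu : (u, s) ∉ N) :
    exchange a b N u (s * a) = s * a := by
  obtain ⟨h1, h2⟩ := h.ne
  have h3 := h.left_ne
  have h4 := h.right_ne
  rcases Int.units_eq_one_or s with rfl | rfl
  · have e1 : ¬ (a = -a) := by omega
    simp [exchange, hu, e1, h1, h2]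
  · have e1 : ¬ (-a = a) := by omega
    have e2 : ¬ (-a = b) := by omega
    have e3 : ¬ (-a = -b) := by omega
    simp [exchange, hu, e1, e2, e3]

theorem exchange_right_of_notMem (h : KempePair k a b) {u : V} {s : ℤˣ} (hu : (u, s) ∉ N) :
    exchange a b N u (s * b) = s * b := by
  obtain ⟨h1, h2⟩ := h.ne
  have h3 := h.left_ne
  have h4 := h.right_ne
  rcases Int.units_eq_one_or s with rfl | rfl
  · have e1 : ¬ (b = -a) := by omega
    have e2 : ¬ (b = a) := by omega
    have e3 : ¬ (b = -b) := by omega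
    simp [exchange, hu, e1, e2, e3]
  · have e1 : ¬ (-b = a) := by omega
    have e2 : ¬ (-b = b) := by omega
    have e3 : ¬ (-b = -a) := by omega
    simp [exchange, hu, e1, e2, e3]

theorem exchange_of_avoids {u : V} {t : ℤ} (ht : Avoids a b t) : exchange a b N u t = t := by
  have h1 : t ≠ a := fun e => ht.1 (by rw [e])
  have h2 : t ≠ b := fun e => ht.2 (by rw [e])
  have h3 : t ≠ -a := fun e => ht.1 (by rw [e, abs_neg])
  have h4 : t ≠ -b := fun e => ht.2 (by rw [e, abs_neg])
  simp [exchange, h1, h2, h3, h4]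

theorem exchange_exchange (h : KempePair k a b) (u : V) (t : ℤ) :
    exchange a b N u (exchange a b N u t) = t := by
  rcases avoids_or a b t with ⟨s, rfl⟩ | ⟨s, rfl⟩ | ht
  · by_cases hs : (u, s) ∈ N
    · rw [exchange_left h hs, exchange_right h hs]
    · rw [exchange_left_of_notMem h hs, exchange_left_of_notMem h hs]
  · by_cases hs : (u, s) ∈ N
    · rw [exchange_right h hs, exchange_left h hs]
    · rw [exchange_right_of_notMem h hs, exchange_right_of_notMem h hs]
  · rw [exchange_of_avoids ht, exchange_of_avoids ht]

theorem exchange_injective (h : KempePair k a b) (u : V) :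
    Function.Injective (exchange a b N u) :=
  Function.LeftInverse.injective (exchange_exchange h u)

theorem exchange_zero (h : KempePair k a b) (u : V) : exchange a b N u 0 = 0 := by
  apply exchange_of_avoids
  rw [Avoids, abs_zero]
  exact ⟨(abs_pos.2 h.left_ne).ne, (abs_pos.2 h.right_ne).ne⟩

theorem exchange_eq_zero (h : KempePair k a b) {u : V} {t : ℤ} :
    exchange a b N u t = 0 ↔ t = 0 := by
  rw [← exchange_zero (N := N) h u, (exchange_injective h u).eq_iff, exchange_zero h]

theorem abs_exchange_le (h : KempePair k a b) {u : V} {t : ℤ} (ht : |t| ≤ k) :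
    |exchange a b N u t| ≤ k := by
  have := h.left_le
  have := h.right_le
  unfold exchange
  split_ifs <;> simpa

/-- The Kempe graph of the colours `±a`, `±b`: the nodes `(u, s)` and `(w, s')` are joined if the
edge `uw` has a colour of the pair `{s a, s b}` at `u` and `s' = -σ(uw) s`, so that its colour at
`w` belongs to the pair `{s' a, s' b}`. -/
def kempeGraph (h : IsPartialColoring G σ k c) (hσ : ∀ u w, σ u w = σ w u) (a b : ℤ)
    (hab : KempePair k a b) : SimpleGraph (V × ℤˣ) where
  Adj n m := (c n.1 m.1 = n.2 * a ∨ c n.1 m.1 = n.2 * b) ∧ m.2 = -σ n.1 m.1 * n.2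
  symm := ⟨by
    rintro ⟨u, s⟩ ⟨w, s'⟩ ⟨h1, h2⟩
    simp only at h1 h2 ⊢
    subst h2
    refine ⟨?_, ?_⟩
    · rw [h.compat u w]
      rcases h1 with h1 | h1 <;> rw [h1] <;> [left; right] <;> push_cast <;> ring
    · rw [hσ w u]
      rcases Int.units_eq_one_or (σ u w) with e | e <;> simp [e]⟩
  loopless := ⟨by
    rintro ⟨u, s⟩ ⟨h1, -⟩
    have h0 : c u u = 0 := by
      by_contra h0
      exact (h.adj h0).ne rfl
    simp only [h0] at h1
    rcases h1 with h1 | h1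
    · exact hab.left_ne (int_unit_mul_eq_zero.1 h1.symm)
    · exact hab.right_ne (int_unit_mul_eq_zero.1 h1.symm)⟩

/-- The partial colouring obtained by interchanging the colours of all pairs in `N`. -/
noncomputable def kempeChange (c : V → V → ℤ) (a b : ℤ) (N : Set (V × ℤˣ)) : V → V → ℤ :=
  fun u w => exchange a b N u (c u w)

theorem misses_kempeChange (hab : KempePair k a b) {u : V} {t : ℤ} :
    Misses (kempeChange c a b N) u t ↔ Misses c u (exchange a b N u t) := by
  refine forall_congr' fun w => not_congr ⟨fun e => ?_, fun e => ?_⟩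
  · rw [← e, kempeChange, exchange_exchange hab]
  · rw [kempeChange, e, exchange_exchange hab]

theorem weight_kempeChange [Fintype V] (hab : KempePair k a b) :
    weight (kempeChange c a b N) = weight c := by
  unfold weight
  congr 1
  ext p
  rw [Finset.mem_filter, Finset.mem_filter]
  simp only [kempeChange, ne_eq, exchange_eq_zero hab]

/-- Interchanging colours on a union of components of the Kempe graph preserves partial
colourings. -/
theorem isPartialColoring_kempeChange (h : IsPartialColoring G σ k c)
    (hσ : ∀ u w, σ u w = σ w u) (hab : KempePair k a b)
    (hN : ∀ n m, (kempeGraph h hσ a b hab).Adj n m → (n ∈ N ↔ m ∈ N)) :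
    IsPartialColoring G σ k (kempeChange c a b N) := by
  refine ⟨fun {u w} h0 => h.adj fun e => h0 ?_, fun u w => ?_, fun u w => ?_,
    fun {u w w'} h0 h1 => ?_⟩
  · rw [kempeChange, e, exchange_zero hab]
  · simp only [kempeChange]
    rw [h.compat u w]
    rcases avoids_or a b (c u w) with ⟨s, e⟩ | ⟨s, e⟩ | ht
    · have hadj := hN (u, s) (w, -σ u w * s) ⟨Or.inl e, rfl⟩
      rw [e, ← mul_assoc, ← Units.val_mul]
      by_cases hu : (u, s) ∈ N
      · rw [exchange_left hab hu, exchange_left hab (hadj.1 hu), Units.val_mul, mul_assoc]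
      · rw [exchange_left_of_notMem hab hu,
          exchange_left_of_notMem hab (fun hw => hu (hadj.2 hw)), Units.val_mul, mul_assoc]
    · have hadj := hN (u, s) (w, -σ u w * s) ⟨Or.inr e, rfl⟩
      rw [e, ← mul_assoc, ← Units.val_mul]
      by_cases hu : (u, s) ∈ N
      · rw [exchange_right hab hu, exchange_right hab (hadj.1 hu), Units.val_mul, mul_assoc]
      · rw [exchange_right_of_notMem hab hu,
          exchange_right_of_notMem hab (fun hw => hu (hadj.2 hw)), Units.val_mul, mul_assoc]
    · rw [exchange_of_avoids ht, exchange_of_avoids (ht.unit_mul _)]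
  · exact abs_exchange_le hab (h.bound u w)
  · refine h.proper (fun e => h0 ?_) (exchange_injective hab u h1)
    rw [kempeChange, e, exchange_zero hab]

variable [Fintype V]

theorem degree_kempeGraph_le (h : IsPartialColoring G σ k c) (hσ : ∀ u w, σ u w = σ w u)
    (hab : KempePair k a b) [DecidableRel (kempeGraph h hσ a b hab).Adj] (n : V × ℤˣ)
    (T : Finset ℤ) (hT : ∀ w, (c n.1 w = n.2 * a ∨ c n.1 w = n.2 * b) → c n.1 w ∈ T) :
    (kempeGraph h hσ a b hab).degree n ≤ T.card := by
  rw [← SimpleGraph.card_neighborFinset_eq_degree]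
  refine Finset.card_le_card_of_injOn (fun m => c n.1 m.1) ?_ ?_
  · intro m hm
    have hm : (kempeGraph h hσ a b hab).Adj n m := by simpa using hm
    exact hT _ hm.1
  · intro m hm m' hm' e
    have hm : (kempeGraph h hσ a b hab).Adj n m := by simpa using hm
    have hm' : (kempeGraph h hσ a b hab).Adj n m' := by simpa using hm'
    have h0 : c n.1 m.1 ≠ 0 := by
      rcases hm.1 with e | e <;> rw [e, Ne, int_unit_mul_eq_zero]
      exacts [hab.left_ne, hab.right_ne]
    have h1 := h.proper h0 e
    exact Prod.ext h1 (by rw [hm.2, hm'.2, h1])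

/-- The node `n` is an end of the Kempe graph: a colour of its pair is missing at its vertex. -/
def IsEnd (c : V → V → ℤ) (a b : ℤ) (n : V × ℤˣ) : Prop :=
  Misses c n.1 (n.2 * a) ∨ Misses c n.1 (n.2 * b)

/-- A component of the Kempe graph has at most two ends. -/
theorem not_reachable_of_isEnd (h : IsPartialColoring G σ k c) (hσ : ∀ u w, σ u w = σ w u)
    (hab : KempePair k a b) {n₁ n₂ n₃ : V × ℤˣ} (h₁₂ : n₁ ≠ n₂) (h₁₃ : n₁ ≠ n₃) (h₂₃ : n₂ ≠ n₃)
    (h₁ : IsEnd c a b n₁) (h₂ : IsEnd c a b n₂) (h₃ : IsEnd c a b n₃)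
    (hr : (kempeGraph h hσ a b hab).Reachable n₁ n₂) :
    ¬ (kempeGraph h hσ a b hab).Reachable n₁ n₃ := by
  classical
  have key : ∀ n, IsEnd c a b n → (kempeGraph h hσ a b hab).degree n ≤ 1 := by
    intro n hn
    rcases hn with hn | hn
    · refine (degree_kempeGraph_le h hσ hab n {(n.2 : ℤ) * b} ?_).trans (by simp)
      intro w hw
      simpa using hw.resolve_left (hn w)
    · refine (degree_kempeGraph_le h hσ hab n {(n.2 : ℤ) * a} ?_).trans (by simp)
      intro w hw
      simpa using hw.resolve_right (hn w)
  refine SimpleGraph.not_reachable_of_degree_le_one _ (fun n => ?_) h₁₂ h₁₃ h₂₃ (key _ h₁)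
    (key _ h₂) (key _ h₃) hr
  refine (degree_kempeGraph_le h hσ hab n {(n.2 : ℤ) * a, (n.2 : ℤ) * b} ?_).trans
    Finset.card_le_two
  intro w hw
  simpa using hw

end Kempe

section Fan

variable {G : SimpleGraph V} {σ : V → V → ℤˣ} {k : ℕ} {c : V → V → ℤ}

/-! ### Fans -/

/-- The vertex `x` offers the colour `t` to `v`: if the edge `vx` had the colour `t` at `v`, then
its colour at `x` would be missing at `x`. -/
def Offers (σ : V → V → ℤˣ) (c : V → V → ℤ) (v x : V) (t : ℤ) : Prop :=
  Misses c x (((-σ v x : ℤˣ) : ℤ) * t)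

/-- A fan at `v`: distinct neighbours `x 0, …, x l` of `v` such that `v (x 0)` is uncoloured and
`x i` offers to `v` the colour of `v (x (i + 1))`, for all `i < l`. Values of `x` beyond `l` are
irrelevant. -/
structure IsFan (G : SimpleGraph V) (σ : V → V → ℤˣ) (c : V → V → ℤ) (v : V) (x : ℕ → V)
    (l : ℕ) : Prop where
  adj : G.Adj v (x 0)
  uncolored : c v (x 0) = 0
  colored : ∀ i < l, c v (x (i + 1)) ≠ 0
  offers : ∀ i < l, Offers σ c v (x i) (c v (x (i + 1)))
  inj : ∀ i ≤ l, ∀ j ≤ l, x i = x j → i = j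

theorem IsFan.mono {v : V} {x : ℕ → V} {l m : ℕ} (hx : IsFan G σ c v x l) (hm : m ≤ l) :
    IsFan G σ c v x m :=
  ⟨hx.adj, hx.uncolored, fun i hi => hx.colored i (by omega), fun i hi => hx.offers i (by omega),
    fun i hi j hj => hx.inj i (by omega) j (by omega)⟩

theorem IsFan.ne_center {v : V} {x : ℕ → V} {l i : ℕ} (h : IsPartialColoring G σ k c)
    (hx : IsFan G σ c v x l) (hi : i ≤ l) : x i ≠ v := by
  cases i with
  | zero => exact hx.adj.ne'
  | succ i => exact (h.adj (hx.colored i (by omega))).ne'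

/-- A fan whose last vertex offers a colour missing at its centre can be shifted: every edge of
the fan takes over the colour of its successor, and the last one gets the missing colour. -/
theorem improvable_of_offers [Fintype V] (hσ : ∀ u w, σ u w = σ w u) {v : V} {l : ℕ} :
    ∀ {c : V → V → ℤ} {x : ℕ → V} {t : ℤ}, IsPartialColoring G σ k c → IsFan G σ c v x l →
      t ≠ 0 → |t| ≤ k → Misses c v t → Offers σ c v (x l) t → Improvable G σ k c := by
  induction l with
  | zero =>
    intro c x t h hx ht htk hv hxl
    refine ⟨setColor σ c v (x 0) t, h.color_edge hσ hx.adj htk hv hxl, ?_⟩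
    rw [weight_setColor hx.adj.ne hx.uncolored (h.eq_zero_comm.1 hx.uncolored) ht]
    omega
  | succ l ih =>
    intro c x t h hx ht htk hv hxl
    set b := c v (x 1) with hb
    have hb0 : b ≠ 0 := hx.colored 0 (by omega)
    have hv1 : v ≠ x 1 := (h.adj hb0).ne
    have hv0 : v ≠ x 0 := hx.adj.ne
    have h10 : x 1 ≠ x 0 := fun e => by simpa using hx.inj 1 (by omega) 0 (by omega) e
    -- the colour `b` moves from the edge `v (x 1)` to the edge `v (x 0)`
    set c₁ := setColor σ c v (x 1) 0 with hc₁
    set c₂ := setColor σ c₁ v (x 0) b with hc₂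
    have hle : ∀ u w, c₁ u w = c u w ∨ c₁ u w = 0 := by
      intro u w
      rw [hc₁]
      unfold setColor
      split_ifs <;> simp
    have h₁ : IsPartialColoring G σ k c₁ := h.uncolor
    have hmiss₁ : ∀ u s, s ≠ 0 → Misses c u s → Misses c₁ u s := by
      intro u s hs hu w e
      rcases hle u w with e' | e'
      · exact hu w (e' ▸ e)
      · exact hs (e.symm.trans e')
    have hvb : Misses c₁ v b := by
      intro w e
      by_cases hw : w = x 1
      · rw [hw, hc₁, setColor_self] at e
        exact hb0 e.symm
      · have e' : c₁ v w = c v w := by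
          rw [hc₁, setColor_of_ne _ (by tauto) (by tauto)]
        exact hw (h.proper (hb ▸ hb0) (hb.symm.trans (e.symm.trans e'))).symm
    have h₂ : IsPartialColoring G σ k c₂ := h₁.color_edge hσ hx.adj (h.bound _ _) hvb
      (hmiss₁ _ _ (by rwa [Ne, int_unit_mul_eq_zero]) (hx.offers 0 (by omega)))
    have hweight : weight c₂ = weight c := by
      have e0 : c₁ v (x 0) = 0 := by
        rw [hc₁, setColor_of_ne _ (by tauto) (by tauto), hx.uncolored]
      rw [hc₂, weight_setColor hv0 e0 (h₁.eq_zero_comm.1 e0) hb0]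
      exact weight_setColor_zero hv1 hb0 (fun e => hb0 (h.eq_zero_comm.2 e))
    have hval : ∀ w, w ≠ x 0 → w ≠ x 1 → c₂ v w = c v w := by
      intro w hw0 hw1
      rw [hc₂, setColor_of_ne _ (by tauto) (by tauto), hc₁,
        setColor_of_ne _ (by tauto) (by tauto)]
    have hmiss₂ : ∀ u s, u ≠ v → u ≠ x 0 → s ≠ 0 → Misses c u s → Misses c₂ u s := by
      intro u s huv hu0 hs hu w
      rw [hc₂, setColor_of_ne _ (by tauto) (by tauto)]
      exact hmiss₁ u s hs hu w
    have hfan : IsFan G σ c₂ v (fun i => x (i + 1)) l := by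
      have hsucc : ∀ i < l, c₂ v (x (i + 2)) = c v (x (i + 2)) := by
        intro i hi
        refine hval _ (fun e => ?_) (fun e => ?_)
        · have := hx.inj (i + 2) (by omega) 0 (by omega) e; omega
        · have := hx.inj (i + 2) (by omega) 1 (by omega) e; omega
      refine ⟨h.adj hb0, ?_, fun i hi => ?_, fun i hi => ?_, fun i hi j hj e => ?_⟩
      · change c₂ v (x 1) = 0
        rw [hc₂, setColor_of_ne _ (by tauto) (by tauto), hc₁, setColor_self]
      · change c₂ v (x (i + 2)) ≠ 0
        rw [hsucc i hi]
        exact hx.colored (i + 1) (by omega)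
      · change Offers σ c₂ v (x (i + 1)) (c₂ v (x (i + 2)))
        rw [hsucc i hi]
        refine hmiss₂ _ _ (hx.ne_center h (by omega)) (fun e => ?_) ?_
          (hx.offers (i + 1) (by omega))
        · have := hx.inj (i + 1) (by omega) 0 (by omega) e; omega
        · rw [Ne, int_unit_mul_eq_zero]
          exact hx.colored (i + 1) (by omega)
      · have := hx.inj (i + 1) (by omega) (j + 1) (by omega) e; omega
    have hv₂ : Misses c₂ v t := by
      intro w e
      by_cases hw0 : w = x 0
      · rw [hw0, hc₂, setColor_self] at e
        exact hv _ (hb ▸ e)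
      · rw [hc₂, setColor_of_ne _ (by tauto) (by tauto)] at e
        exact hmiss₁ v t ht hv w e
    obtain ⟨c', h', hc'⟩ := ih h₂ hfan ht htk hv₂
      (hmiss₂ _ _ (hx.ne_center h le_rfl)
        (fun e => by have := hx.inj (l + 1) (by omega) 0 (by omega) e; omega)
        (by rwa [Ne, int_unit_mul_eq_zero]) hxl)
    exact ⟨c', h', hweight ▸ hc'⟩

/-- Maximal fans: for a function `κ` of colours, there is a fan whose edges have colours with
distinct values of `κ` and such that, for every colour `t` offered by its last vertex and present
at its centre, the value `κ t` occurs in the fan. -/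
theorem exists_maximal_fan [Fintype V] {v y : V}
    (hvy : G.Adj v y) (hc : c v y = 0) (κ : ℤ → ℤ) :
    ∃ x l, IsFan G σ c v x l ∧
      (∀ i < l, ∀ j < l, κ (c v (x (i + 1))) = κ (c v (x (j + 1))) → i = j) ∧
      ∀ w, c v w ≠ 0 → Offers σ c v (x l) (c v w) → ∃ p < l, κ (c v (x (p + 1))) = κ (c v w) := by
  by_contra hcon
  push Not at hcon
  have key : ∀ l : ℕ, ∃ x, IsFan G σ c v x l ∧
      (∀ i < l, ∀ j < l, κ (c v (x (i + 1))) = κ (c v (x (j + 1))) → i = j) := by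
    intro l
    induction l with
    | zero => exact ⟨fun _ => y, ⟨hvy, hc, by simp, by simp, fun i hi j hj _ => by omega⟩, by simp⟩
    | succ l ih =>
      obtain ⟨x, hx, hκ⟩ := ih
      obtain ⟨w, hw, hoff, hnew⟩ := hcon x l hx hκ
      have hxw : ∀ i ≤ l, x i ≠ w := by
        intro i hi e
        cases i with
        | zero => exact hw (e ▸ hx.uncolored)
        | succ i => exact hnew i (by omega) (by rw [e])
      have hle : ∀ i ≤ l, Function.update x (l + 1) w i = x i := fun i hi =>
        Function.update_of_ne (by omega) _ _
      have hself : Function.update x (l + 1) w (l + 1) = w := Function.update_self ..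
      refine ⟨Function.update x (l + 1) w, ⟨?_, ?_, fun i hi => ?_, fun i hi => ?_,
        fun i hi j hj e => ?_⟩, fun i hi j hj e => ?_⟩
      · rw [hle 0 (by omega)]; exact hx.adj
      · rw [hle 0 (by omega)]; exact hx.uncolored
      · rcases Nat.lt_succ_iff_lt_or_eq.1 hi with hi | rfl
        · rw [hle _ hi]; exact hx.colored i hi
        · rw [hself]; exact hw
      · rw [hle i (by omega)]
        rcases Nat.lt_succ_iff_lt_or_eq.1 hi with hi | rfl
        · rw [hle _ hi]; exact hx.offers i hi
        · rw [hself]; exact hoff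
      · rcases Nat.le_succ_iff.1 hi with hi | rfl <;> rcases Nat.le_succ_iff.1 hj with hj | rfl
        · rw [hle i hi, hle j hj] at e
          exact hx.inj i hi j hj e
        · rw [hle i hi, hself] at e
          exact absurd e (hxw i hi)
        · rw [hle j hj, hself] at e
          exact absurd e.symm (hxw j hj)
        · rfl
      · rcases Nat.lt_succ_iff_lt_or_eq.1 hi with hi | rfl <;>
          rcases Nat.lt_succ_iff_lt_or_eq.1 hj with hj | rfl
        · rw [hle _ hi, hle _ hj] at e
          exact hκ i hi j hj e
        · rw [hle _ hi, hself] at e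
          exact absurd e (hnew i hi)
        · rw [hle _ hj, hself] at e
          exact absurd e.symm (hnew j hj)
        · rfl
  obtain ⟨x, hx, -⟩ := key (Fintype.card V)
  have hcard := Fintype.card_le_of_injective (fun i : Fin (Fintype.card V + 1) => x i)
    (fun i j e => Fin.ext (hx.inj _ (by omega) _ (by omega) e))
  simp at hcard

end Fan

section Improve

variable {G : SimpleGraph V} {σ : V → V → ℤˣ} {k : ℕ} {c : V → V → ℤ} {a b : ℤ}
  {N : Set (V × ℤˣ)}

/-! ### Kempe changes and fans -/

theorem unit_mul_unit_mul (r s : ℤˣ) (t : ℤ) :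
    (r : ℤ) * ((s : ℤ) * t) = ((r * s : ℤˣ) : ℤ) * t := by
  push_cast; ring

section Transfer

variable {v : V} {s : ℤˣ}

theorem misses_left_iff (hab : KempePair k a b) (hs : (v, s) ∈ N) :
    Misses (kempeChange c a b N) v (s * a) ↔ Misses c v (s * b) := by
  rw [misses_kempeChange hab, exchange_left hab hs]

theorem misses_right_iff (hab : KempePair k a b) (hs : (v, s) ∈ N) :
    Misses (kempeChange c a b N) v (s * b) ↔ Misses c v (s * a) := by
  rw [misses_kempeChange hab, exchange_right hab hs]

theorem misses_left_iff_of_notMem (hab : KempePair k a b) (hs : (v, s) ∉ N) :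
    Misses (kempeChange c a b N) v (s * a) ↔ Misses c v (s * a) := by
  rw [misses_kempeChange hab, exchange_left_of_notMem hab hs]

theorem misses_right_iff_of_notMem (hab : KempePair k a b) (hs : (v, s) ∉ N) :
    Misses (kempeChange c a b N) v (s * b) ↔ Misses c v (s * b) := by
  rw [misses_kempeChange hab, exchange_right_of_notMem hab hs]

theorem misses_iff_of_avoids (hab : KempePair k a b) {t : ℤ} (ht : Avoids a b t) :
    Misses (kempeChange c a b N) v t ↔ Misses c v t := by
  rw [misses_kempeChange hab, exchange_of_avoids ht]

/-- A fan survives a Kempe change if the change affects neither its edges at the centre nor the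
offers that define it. -/
theorem IsFan.kempeChange (hab : KempePair k a b) {y : ℕ → V} {l : ℕ} (hy : IsFan G σ c v y l)
    (hkeep : ∀ i < l, Avoids a b (c v (y (i + 1))) ∨
      ∃ s : ℤˣ, c v (y (i + 1)) = s * b ∧ (v, s) ∉ N ∧ (y i, -σ v (y i) * s) ∉ N) :
    IsFan G σ (kempeChange c a b N) v y l := by
  have hval : ∀ i < l, SignedVizing.kempeChange c a b N v (y (i + 1)) = c v (y (i + 1)) := by
    intro i hi
    rw [SignedVizing.kempeChange]
    rcases hkeep i hi with h1 | ⟨s, h1, h2, -⟩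
    · exact exchange_of_avoids h1
    · rw [h1, exchange_right_of_notMem hab h2]
  refine ⟨hy.adj, ?_, fun i hi => ?_, fun i hi => ?_, hy.inj⟩
  · rw [SignedVizing.kempeChange, hy.uncolored, exchange_zero hab]
  · rw [hval i hi]
    exact hy.colored i hi
  · rw [hval i hi, Offers]
    have hoff := hy.offers i hi
    rcases hkeep i hi with h1 | ⟨s, h1, -, h2⟩
    · rwa [misses_iff_of_avoids hab (h1.unit_mul _)]
    · rw [Offers] at hoff
      rw [h1, unit_mul_unit_mul] at hoff ⊢
      rwa [misses_right_iff_of_notMem hab h2]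

end Transfer

theorem Offers.isEnd {v x : V} {s : ℤˣ} (h : Offers σ c v x (s * b)) :
    IsEnd c a b (x, -σ v x * s) := by
  right
  rwa [Offers, unit_mul_unit_mul] at h

/-- The component of the node `n` in the Kempe graph. -/
def kempeComponent (h : IsPartialColoring G σ k c) (hσ : ∀ u w, σ u w = σ w u)
    (hab : KempePair k a b) (n : V × ℤˣ) : Set (V × ℤˣ) :=
  {m | (kempeGraph h hσ a b hab).Reachable n m}

theorem isPartialColoring_kempeChange_component (h : IsPartialColoring G σ k c)
    (hσ : ∀ u w, σ u w = σ w u) (hab : KempePair k a b) (n : V × ℤˣ) :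
    IsPartialColoring G σ k (kempeChange c a b (kempeComponent h hσ hab n)) :=
  isPartialColoring_kempeChange h hσ hab fun _ _ hadj =>
    ⟨fun hn => SimpleGraph.Reachable.trans hn hadj.reachable,
      fun hm => SimpleGraph.Reachable.trans hm hadj.symm.reachable⟩

/-- Every vertex misses one of the colours `±1, …, ±k`. -/
def HasMissing (k : ℕ) (c : V → V → ℤ) : Prop := ∀ u, ∃ t : ℤ, t ≠ 0 ∧ |t| ≤ k ∧ Misses c u t

theorem HasMissing.kempeChange (hab : KempePair k a b) (h : HasMissing k c) :
    HasMissing k (kempeChange c a b N) := by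
  intro u
  obtain ⟨t, ht, htk, hu⟩ := h u
  exact ⟨exchange a b N u t, by rwa [Ne, exchange_eq_zero hab], abs_exchange_le hab htk,
    by rwa [misses_kempeChange hab, exchange_exchange hab]⟩

theorem HasMissing.exists_offers (h : HasMissing k c) (v x : V) :
    ∃ t : ℤ, t ≠ 0 ∧ |t| ≤ k ∧ Offers σ c v x t := by
  obtain ⟨t, ht, htk, hx⟩ := h x
  refine ⟨((-σ v x : ℤˣ) : ℤ) * t, by rwa [Ne, int_unit_mul_eq_zero], ?_, ?_⟩
  · rwa [abs_int_unit_mul]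
  · rwa [Offers, int_unit_mul_self]

variable [Fintype V]

/-- Of three distinct ends in the Kempe graph, if the component of the second contains the first,
then the component of the third contains neither of them. -/
theorem notMem_kempeComponent (h : IsPartialColoring G σ k c) (hσ : ∀ u w, σ u w = σ w u)
    (hab : KempePair k a b) {n₁ n₂ n₃ : V × ℤˣ} (h₁₂ : n₁ ≠ n₂) (h₁₃ : n₁ ≠ n₃) (h₂₃ : n₂ ≠ n₃)
    (h₁ : IsEnd c a b n₁) (h₂ : IsEnd c a b n₂) (h₃ : IsEnd c a b n₃)
    (hr : n₁ ∈ kempeComponent h hσ hab n₂) :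
    n₁ ∉ kempeComponent h hσ hab n₃ ∧ n₂ ∉ kempeComponent h hσ hab n₃ := by
  have hr : (kempeGraph h hσ a b hab).Reachable n₂ n₁ := hr
  have key := not_reachable_of_isEnd h hσ hab h₁₂ h₁₃ h₂₃ h₁ h₂ h₃ hr.symm
  exact ⟨fun h13 => key (SimpleGraph.Reachable.symm h13),
    fun h23 => key (hr.symm.trans (SimpleGraph.Reachable.symm h23))⟩

theorem Improvable.of_kempeChange (hab : KempePair k a b)
    (h : Improvable G σ k (kempeChange c a b N)) : Improvable G σ k c := by
  obtain ⟨c', h', hc'⟩ := h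
  exact ⟨c', h', by rwa [weight_kempeChange hab] at hc'⟩

/-! ### Improving a partial colouring -/

/-- If a colour and its negative are both missing at the centre, then a Kempe change at the last
vertex of a maximal fan, or at the vertex that offers the same colour before, yields a fan that
can be shifted. -/
theorem improvable_of_misses_neg (h : IsPartialColoring G σ k c) (hσ : ∀ u w, σ u w = σ w u)
    (hmiss : HasMissing k c) {v y : V} (hvy : G.Adj v y) (hc : c v y = 0) (ha : a ≠ 0)
    (hak : |a| ≤ k) (hva : ∀ s : ℤˣ, Misses c v (s * a)) : Improvable G σ k c := by
  obtain ⟨x, l, hx, hκ, hmax⟩ := exists_maximal_fan (σ := σ) hvy hc id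
  obtain ⟨t, ht, htk, hoff⟩ := hmiss.exists_offers (σ := σ) v (x l)
  by_cases hvt : Misses c v t
  · exact improvable_of_offers hσ h hx ht htk hvt hoff
  unfold Misses at hvt
  push Not at hvt
  obtain ⟨w, rfl⟩ := hvt
  obtain ⟨p, hp, hpb⟩ := hmax w ht hoff
  set b := c v w with hb
  simp only [id] at hpb hκ
  have hab : KempePair k a b := by
    refine ⟨ha, ht, hak, htk, fun e => ?_⟩
    obtain ⟨s, hs⟩ := exists_unit_mul_of_abs_eq e.symm
    exact hva s w hs
  have hoffp : Offers σ c v (x p) b := hpb ▸ hx.offers p hp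
  have hend : ∀ q, Offers σ c v (x q) b → IsEnd c a b (x q, -σ v (x q)) := by
    intro q hq
    simpa using Offers.isEnd (s := 1) (a := a) (by simpa using hq)
  have hvend : ∀ s : ℤˣ, IsEnd c a b (v, s) := fun s => Or.inl (hva s)
  -- The change at `x q` lets `x q` offer `a`. It can destroy the fan only at the edge of colour
  -- `-b`, and then the fan up to that edge can be shifted instead.
  have step : ∀ q ≤ l, Offers σ c v (x q) b →
      (v, 1) ∉ kempeComponent h hσ hab (x q, -σ v (x q)) →
      (∀ i < q, c v (x (i + 1)) = b →
        (x i, -σ v (x i)) ∉ kempeComponent h hσ hab (x q, -σ v (x q))) →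
      Improvable G σ k c := by
    intro q hq hoffq hv1 hkeep
    set N := kempeComponent h hσ hab (x q, -σ v (x q)) with hN
    have hself : (x q, -σ v (x q)) ∈ N := SimpleGraph.Reachable.refl _
    apply Improvable.of_kempeChange hab (N := N)
    have h' := isPartialColoring_kempeChange_component h hσ hab (x q, -σ v (x q))
    rw [← hN] at h'
    have hfan : ∀ m ≤ q, (∀ i < m, c v (x (i + 1)) = ((-1 : ℤˣ) : ℤ) * b →
        (v, -1) ∉ N ∧ (x i, -σ v (x i) * -1) ∉ N) →
        IsFan G σ (kempeChange c a b N) v x m := by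
      intro m hm hkeep'
      refine (hx.mono (hm.trans hq)).kempeChange hab fun i hi => ?_
      rcases avoids_or a b (c v (x (i + 1))) with ⟨s, e⟩ | ⟨s, e⟩ | e
      · exact absurd e (hva s _)
      · right
        refine ⟨s, e, ?_⟩
        rcases Int.units_eq_one_or s with rfl | rfl
        · refine ⟨hv1, ?_⟩
          rw [mul_one]
          exact hkeep i (by omega) (by simpa using e)
        · exact hkeep' i hi e
      · exact Or.inl e
    by_cases hbad : ∃ i < q, c v (x (i + 1)) = ((-1 : ℤˣ) : ℤ) * b ∧
        ((v, -1) ∈ N ∨ (x i, -σ v (x i) * -1) ∈ N)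
    · obtain ⟨i, hi, hib, hbad⟩ := hbad
      have hfi : IsFan G σ (kempeChange c a b N) v x i := by
        refine hfan i hi.le fun j hj hjb => ?_
        have := hκ j (by omega) i (by omega) (hjb.trans hib.symm)
        omega
      have hoffi := hx.offers i (by omega)
      rw [hib] at hoffi
      have hoffi' := hoffi
      rw [Offers, unit_mul_unit_mul] at hoffi'
      by_cases hv2 : (v, -1) ∈ N
      · refine improvable_of_offers hσ h' hfi (t := ((-1 : ℤˣ) : ℤ) * b) ?_ ?_ ?_ ?_
        · rw [Ne, int_unit_mul_eq_zero]; exact ht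
        · rw [abs_int_unit_mul]; exact htk
        · rw [misses_right_iff hab hv2]; exact hva _
        · -- `(v, -1)` and `(x q, _)` are the two ends of the component
          have hnot : (x i, -σ v (x i) * -1) ∉ N := by
            have hqi : x q ≠ x i := fun e => by
              have := hx.inj q hq i (by omega) e; omega
            intro hmem
            refine not_reachable_of_isEnd h hσ hab ?_ ?_ ?_ (hend q hoffq) (hvend (-1))
              hoffi.isEnd hv2 hmem
            · exact fun e => hx.ne_center h hq (congrArg Prod.fst e)
            · exact fun e => hqi (congrArg Prod.fst e)
            · exact fun e => hx.ne_center h (show i ≤ l by omega) (congrArg Prod.fst e).symm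
          rw [Offers, unit_mul_unit_mul, misses_right_iff_of_notMem hab hnot]
          exact hoffi'
      · refine improvable_of_offers hσ h' hfi (t := ((-1 : ℤˣ) : ℤ) * a) ?_ ?_ ?_ ?_
        · rw [Ne, int_unit_mul_eq_zero]; exact ha
        · rw [abs_int_unit_mul]; exact hak
        · rw [misses_left_iff_of_notMem hab hv2]; exact hva _
        · rw [Offers, unit_mul_unit_mul, misses_left_iff hab (hbad.resolve_left hv2)]
          exact hoffi'
    · refine improvable_of_offers hσ h' (hfan q le_rfl fun i hi hib => ?_) ha hak ?_ ?_
      · push Not at hbad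
        exact hbad i hi hib
      · have := (misses_left_iff_of_notMem (c := c) hab hv1).2 (hva 1)
        simpa using this
      · rw [Offers, misses_left_iff hab hself]
        exact hoffq
  by_cases hr : (v, 1) ∈ kempeComponent h hσ hab (x p, -σ v (x p))
  · obtain ⟨h1, h2⟩ := notMem_kempeComponent h hσ hab (n₃ := (x l, -σ v (x l)))
      (fun e => hx.ne_center h hp.le (congrArg Prod.fst e).symm)
      (fun e => hx.ne_center h le_rfl (congrArg Prod.fst e).symm)
      (fun e => hp.ne (hx.inj p hp.le l le_rfl (congrArg Prod.fst e)))
      (hvend 1) (hend p hoffp) (hend l hoff) hr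
    refine step l le_rfl hoff h1 fun i hi hib => ?_
    rwa [hκ i hi p hp (hib.trans hpb.symm)]
  · refine step p hp.le hoffp hr fun i hi hib => ?_
    have := hκ i (by omega) p hp (hib.trans hpb.symm)
    omega

variable {a₁ a₂ : ℤ}

/-- If `a₁` and `a₂` are missing at the centre and the last vertex of a fan is the only one that
offers one of `±a₁`, `±a₂`, then the partial colouring can be improved: a Kempe change that
interchanges `a₁` with `-a₂` makes the fan shiftable or makes `a₂` and `-a₂` missing at the
centre. -/
theorem improvable_of_offers_unit_mul_aux (h : IsPartialColoring G σ k c)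
    (hσ : ∀ u w, σ u w = σ w u)
    (hmiss : HasMissing k c) {v : V} (h₁ : a₁ ≠ 0) (h₂ : a₂ ≠ 0) (hk₁ : |a₁| ≤ k)
    (hk₂ : |a₂| ≤ k) (hv₁ : Misses c v a₁) (hv₂ : Misses c v a₂) (hne : |a₁| ≠ |a₂|) {x : ℕ → V}
    {l : ℕ} (hx : IsFan G σ c v x l)
    (hmin : ∀ i < l, ∀ s : ℤˣ, ¬ Offers σ c v (x i) (s * a₁) ∧ ¬ Offers σ c v (x i) (s * a₂))
    (s : ℤˣ) (hoff : Offers σ c v (x l) (s * a₂)) : Improvable G σ k c := by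
  rcases Int.units_eq_one_or s with rfl | rfl
  · exact improvable_of_offers hσ h hx h₂ hk₂ hv₂ (by simpa using hoff)
  have hab : KempePair k a₁ (-a₂) :=
    ⟨h₁, neg_ne_zero.2 h₂, hk₁, by rwa [abs_neg], by rwa [abs_neg]⟩
  have hoff' : Offers σ c v (x l) (((1 : ℤˣ) : ℤ) * -a₂) := by simpa using hoff
  have hend₁ : IsEnd c a₁ (-a₂) (v, 1) := Or.inl (by simpa using hv₁)
  have hend₂ : IsEnd c a₁ (-a₂) (v, -1) := Or.inr (by simpa using hv₂)
  have hxv := hx.ne_center h le_rfl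
  by_cases hr : (v, -1) ∈ kempeComponent h hσ hab (v, 1)
  · -- the two nodes of `v` are the ends of one component, and the last vertex lies in another
    obtain ⟨hn₂, hn₁⟩ := notMem_kempeComponent h hσ hab (by simp)
      (fun e => hxv (congrArg Prod.fst e).symm) (fun e => hxv (congrArg Prod.fst e).symm)
      hend₂ hend₁ hoff'.isEnd hr
    set n : V × ℤˣ := (x l, -σ v (x l) * 1) with hn
    have hself : n ∈ kempeComponent h hσ hab n := SimpleGraph.Reachable.refl _
    apply Improvable.of_kempeChange hab (N := kempeComponent h hσ hab n)
    refine improvable_of_offers hσ (isPartialColoring_kempeChange_component h hσ hab n)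
      (hx.kempeChange hab fun i hi => ?_) h₁ hk₁ ?_ ?_
    · have hoffi := hx.offers i hi
      rcases avoids_or a₁ (-a₂) (c v (x (i + 1))) with ⟨s, e⟩ | ⟨s, e⟩ | e
      · exact absurd (e ▸ hoffi) (hmin i hi s).1
      · refine absurd ?_ (hmin i hi (-s)).2
        rw [e] at hoffi
        simpa using hoffi
      · exact Or.inl e
    · have := (misses_left_iff_of_notMem (c := c) hab hn₁).2 (by simpa using hv₁)
      simpa using this
    · have := (misses_left_iff (c := c) hab hself).2
        (by rwa [Offers, unit_mul_unit_mul] at hoff')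
      simpa [Offers] using this
  · have hself : (v, 1) ∈ kempeComponent h hσ hab (v, 1) := SimpleGraph.Reachable.refl _
    apply Improvable.of_kempeChange hab (N := kempeComponent h hσ hab (v, 1))
    refine improvable_of_misses_neg (a := -a₂)
      (isPartialColoring_kempeChange_component h hσ hab (v, 1)) hσ (hmiss.kempeChange hab)
      hx.adj ?_ hab.right_ne hab.right_le fun s => ?_
    · rw [kempeChange, hx.uncolored, exchange_zero hab]
    · rcases Int.units_eq_one_or s with rfl | rfl
      · rw [misses_right_iff hab hself]
        simpa using hv₁
      · rw [misses_right_iff_of_notMem hab hr]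
        simpa using hv₂

/-- If `a₁ ≠ a₂` are missing at the centre of a fan whose last vertex offers one of `±a₁`, `±a₂`,
then the partial colouring can be improved. -/
theorem improvable_of_offers_unit_mul (h : IsPartialColoring G σ k c)
    (hσ : ∀ u w, σ u w = σ w u)
    (hmiss : HasMissing k c) {v : V} (h₁ : a₁ ≠ 0) (h₂ : a₂ ≠ 0) (hk₁ : |a₁| ≤ k)
    (hk₂ : |a₂| ≤ k) (hv₁ : Misses c v a₁) (hv₂ : Misses c v a₂) (hne : |a₁| ≠ |a₂|) {x : ℕ → V}
    {l : ℕ} (hx : IsFan G σ c v x l)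
    {s : ℤˣ} (hoff : Offers σ c v (x l) (s * a₁) ∨ Offers σ c v (x l) (s * a₂)) :
    Improvable G σ k c := by
  induction l using Nat.strong_induction_on generalizing s with
  | _ l ih =>
    by_cases hsmall : ∃ i < l, ∃ s : ℤˣ,
        Offers σ c v (x i) (s * a₁) ∨ Offers σ c v (x i) (s * a₂)
    · obtain ⟨i, hi, s', hs'⟩ := hsmall
      exact ih i hi (hx.mono hi.le) hs'
    · push Not at hsmall
      rcases hoff with hoff | hoff
      · exact improvable_of_offers_unit_mul_aux h hσ hmiss h₂ h₁ hk₂ hk₁ hv₂ hv₁ hne.symm hx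
          (fun i hi s => (hsmall i hi s).symm) s hoff
      · exact improvable_of_offers_unit_mul_aux h hσ hmiss h₁ h₂ hk₁ hk₂ hv₁ hv₂ hne hx
          hsmall s hoff

/-- If every vertex misses a colour and some vertex with an uncoloured edge misses two colours,
then more edges can be coloured. -/
theorem IsPartialColoring.improvable (h : IsPartialColoring G σ k c)
    (hσ : ∀ u w, σ u w = σ w u) (hmiss : HasMissing k c) {v y : V} (hvy : G.Adj v y)
    (hc : c v y = 0) (h₁ : a₁ ≠ 0) (h₂ : a₂ ≠ 0) (hk₁ : |a₁| ≤ k) (hk₂ : |a₂| ≤ k)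
    (hv₁ : Misses c v a₁) (hv₂ : Misses c v a₂) (hne : a₁ ≠ a₂) : Improvable G σ k c := by
  by_cases habs : |a₁| = |a₂|
  · have hneg : a₂ = -a₁ := by
      rcases abs_eq_abs.1 habs with e | e <;> omega
    refine improvable_of_misses_neg h hσ hmiss hvy hc h₁ hk₁ fun s => ?_
    rcases Int.units_eq_one_or s with rfl | rfl
    · simpa using hv₁
    · simpa [hneg] using hv₂
  by_contra hnot
  -- no two edges of the fan have colours that are equal up to sign
  obtain ⟨x, l, hx, hκ, hmax⟩ := exists_maximal_fan (σ := σ) hvy hc abs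
  have hno : ∀ i ≤ l, ∀ s : ℤˣ,
      ¬ Offers σ c v (x i) (s * a₁) ∧ ¬ Offers σ c v (x i) (s * a₂) := by
    intro i hi s
    constructor <;> intro hoff <;> apply hnot
    · exact improvable_of_offers_unit_mul h hσ hmiss h₁ h₂ hk₁ hk₂ hv₁ hv₂ habs (hx.mono hi)
        (Or.inl hoff)
    · exact improvable_of_offers_unit_mul h hσ hmiss h₁ h₂ hk₁ hk₂ hv₁ hv₂ habs (hx.mono hi)
        (Or.inr hoff)
  obtain ⟨t, ht, htk, hoff⟩ := hmiss.exists_offers (σ := σ) v (x l)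
  by_cases hvt : Misses c v t
  · exact hnot (improvable_of_offers hσ h hx ht htk hvt hoff)
  unfold Misses at hvt
  push Not at hvt
  obtain ⟨w, rfl⟩ := hvt
  obtain ⟨p, hp, hpb⟩ := hmax w ht hoff
  set b := c v (x (p + 1)) with hb
  obtain ⟨s, hs⟩ := exists_unit_mul_of_abs_eq hpb.symm
  rw [hs] at hoff
  have hoffp : Offers σ c v (x p) b := hx.offers p hp
  have hab : KempePair k a₁ b := by
    refine ⟨h₁, hx.colored p hp, hk₁, h.bound _ _, fun e => ?_⟩
    obtain ⟨s, hs⟩ := exists_unit_mul_of_abs_eq e.symm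
    exact (hno p hp.le s).1 (hs ▸ hoffp)
  have hab₂ : Avoids a₁ b a₂ := by
    refine ⟨Ne.symm habs, fun e => ?_⟩
    obtain ⟨s, hs⟩ := exists_unit_mul_of_abs_eq e.symm
    exact (hno p hp.le s).2 (hs ▸ hoffp)
  have havoid : ∀ i < l, i ≠ p → Avoids a₁ b (c v (x (i + 1))) := by
    intro i hi hip
    refine ⟨fun e => ?_, fun e => hip (hκ i hi p hp e)⟩
    obtain ⟨s, hs⟩ := exists_unit_mul_of_abs_eq e
    exact (hno i hi.le s).1 (hs ▸ hx.offers i hi)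
  have hendv : IsEnd c a₁ b (v, 1) := Or.inl (by simpa using hv₁)
  have hendp : IsEnd c a₁ b (x p, -σ v (x p) * 1) := Offers.isEnd (by simpa using hoffp)
  by_cases hr : (v, 1) ∈ kempeComponent h hσ hab (x p, -σ v (x p) * 1)
  · -- then the component of the last vertex avoids `v` and `x p`, so the fan survives the change
    obtain ⟨hn, hnp⟩ := notMem_kempeComponent h hσ hab
      (fun e => hx.ne_center h hp.le (congrArg Prod.fst e).symm)
      (fun e => hx.ne_center h le_rfl (congrArg Prod.fst e).symm)
      (fun e => hp.ne (hx.inj p hp.le l le_rfl (congrArg Prod.fst e)))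
      hendv hendp (hoff.isEnd (a := a₁)) hr
    set n : V × ℤˣ := (x l, -σ v (x l) * s) with hndef
    have hself : n ∈ kempeComponent h hσ hab n := SimpleGraph.Reachable.refl _
    apply hnot
    apply Improvable.of_kempeChange hab (N := kempeComponent h hσ hab n)
    refine improvable_of_offers_unit_mul (s := s)
      (isPartialColoring_kempeChange_component h hσ hab n) hσ (hmiss.kempeChange hab)
      h₁ h₂ hk₁ hk₂ ?_ ?_ habs
      (hx.kempeChange hab fun i hi => ?_) (Or.inl ?_)
    · have := (misses_left_iff_of_notMem (c := c) hab hn).2 (by simpa using hv₁)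
      simpa using this
    · rwa [misses_iff_of_avoids hab hab₂]
    · by_cases hip : i = p
      · subst hip
        exact Or.inr ⟨1, by simp [hb], hn, hnp⟩
      · exact Or.inl (havoid i hi hip)
    · rw [Offers, unit_mul_unit_mul] at hoff ⊢
      exact (misses_left_iff hab hself).2 hoff
  · set n : V × ℤˣ := (x p, -σ v (x p) * 1) with hndef
    have hself : n ∈ kempeComponent h hσ hab n := SimpleGraph.Reachable.refl _
    apply hnot
    apply Improvable.of_kempeChange hab (N := kempeComponent h hσ hab n)
    refine improvable_of_offers hσ (isPartialColoring_kempeChange_component h hσ hab n)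
      ((hx.mono hp.le).kempeChange hab fun i hi => Or.inl (havoid i (by omega) (by omega)))
      h₁ hk₁ ?_ ?_
    · have := (misses_left_iff_of_notMem (c := c) hab hr).2 (by simpa using hv₁)
      simpa using this
    · have := (misses_left_iff (c := c) hab hself).2 (by simpa [Offers] using hoffp)
      simpa [Offers] using this

end Improve

section Existence

variable {G : SimpleGraph V} {σ : V → V → ℤˣ} {k : ℕ} {c : V → V → ℤ}

/-! ### Colouring all edges -/

open Classical in
/-- The colours among `±1, …, ±k` that do not occur at `u` on the edges from `u` to `B`. -/
noncomputable def missingColors (k : ℕ) (c : V → V → ℤ) (u : V) (B : Finset V) : Finset ℤ :=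
  (Finset.Icc (-(k : ℤ)) k).erase 0 \ B.image (c u)

theorem le_card_missingColors (u : V) (B : Finset V) :
    2 * k ≤ (missingColors k c u B).card + B.card := by
  classical
  have h1 : ((Finset.Icc (-(k : ℤ)) k).erase 0).card = 2 * k := by
    rw [Finset.card_erase_of_mem (by simp), Int.card_Icc]
    omega
  have h2 := Finset.le_card_sdiff (B.image (c u)) ((Finset.Icc (-(k : ℤ)) k).erase 0)
  have h3 : (B.image (c u)).card ≤ B.card := Finset.card_image_le
  have h4 : (missingColors k c u B).card =
      ((Finset.Icc (-(k : ℤ)) k).erase 0 \ B.image (c u)).card := rfl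
  omega

theorem misses_of_mem_missingColors {u : V} {B : Finset V} (hB : ∀ w, c u w ≠ 0 → w ∈ B) {t : ℤ}
    (ht : t ∈ missingColors k c u B) : t ≠ 0 ∧ |t| ≤ k ∧ Misses c u t := by
  classical
  unfold missingColors at ht
  rw [Finset.mem_sdiff, Finset.mem_erase, Finset.mem_Icc] at ht
  obtain ⟨⟨h0, h1⟩, h2⟩ := ht
  refine ⟨h0, abs_le.2 h1, fun w e => h2 (Finset.mem_image.2 ⟨w, hB w ?_, e⟩)⟩
  rwa [e]

/-- If all degrees are less than `2 * k`, a partial colouring with an uncoloured edge can be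
improved: an end of that edge misses two colours. -/
theorem IsPartialColoring.improvable_of_degree_lt [Fintype V] [DecidableRel G.Adj]
    (h : IsPartialColoring G σ k c) (hσ : ∀ u w, σ u w = σ w u) (hdeg : ∀ u, G.degree u < 2 * k)
    {v y : V} (hvy : G.Adj v y) (hc : c v y = 0) : Improvable G σ k c := by
  classical
  have hmiss : HasMissing k c := by
    intro u
    have hcard := le_card_missingColors (k := k) (c := c) u (G.neighborFinset u)
    rw [G.card_neighborFinset_eq_degree] at hcard
    have := hdeg u
    obtain ⟨t, ht⟩ := Finset.card_pos.1
      (show 0 < (missingColors k c u (G.neighborFinset u)).card by omega)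
    exact ⟨t, misses_of_mem_missingColors (fun w hw => by simpa using h.adj hw) ht⟩
  have hcard := le_card_missingColors (k := k) (c := c) v ((G.neighborFinset v).erase y)
  rw [Finset.card_erase_of_mem (by simpa using hvy), G.card_neighborFinset_eq_degree] at hcard
  have hv := hdeg v
  have hpos : 0 < G.degree v := (G.degree_pos_iff_exists_adj v).2 ⟨y, hvy⟩
  obtain ⟨a₁, ha₁, a₂, ha₂, hne⟩ := Finset.one_lt_card.1
    (show 1 < (missingColors k c v ((G.neighborFinset v).erase y)).card by omega)
  have hB : ∀ w, c v w ≠ 0 → w ∈ (G.neighborFinset v).erase y := by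
    intro w hw
    refine Finset.mem_erase.2 ⟨fun e => hw (e ▸ hc), by simpa using h.adj hw⟩
  obtain ⟨h1, hk1, hm1⟩ := misses_of_mem_missingColors hB ha₁
  obtain ⟨h2, hk2, hm2⟩ := misses_of_mem_missingColors hB ha₂
  exact h.improvable hσ hmiss hvy hc h1 h2 hk1 hk2 hm1 hm2 hne

theorem exists_isPartialColoring_forall_ne_zero [Fintype V] [DecidableRel G.Adj]
    (hσ : ∀ u w, σ u w = σ w u) (hdeg : ∀ u, G.degree u < 2 * k) :
    ∃ c, IsPartialColoring G σ k c ∧ ∀ u w, G.Adj u w → c u w ≠ 0 := by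
  classical
  by_contra hcon
  push Not at hcon
  have key : ∀ n : ℕ, ∃ c, IsPartialColoring G σ k c ∧ n ≤ weight c := by
    intro n
    induction n with
    | zero => exact ⟨fun _ _ => 0, ⟨by simp, by simp, by simp, by simp⟩, Nat.zero_le _⟩
    | succ n ih =>
      obtain ⟨c, h, hn⟩ := ih
      obtain ⟨v, y, hvy, hc⟩ := hcon c h
      obtain ⟨c', h', hlt⟩ := h.improvable_of_degree_lt hσ hdeg hvy hc
      exact ⟨c', h', by omega⟩
  obtain ⟨c, -, hn⟩ := key (Fintype.card (V × V) + 1)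
  have : weight c ≤ Fintype.card (V × V) := Finset.card_le_univ _
  omega

end Existence

/-! ### Colourings of signed graphs -/

section SignedGraph

variable (S : SignedGraph V)

open Classical in
/-- The signature as a function of pairs of vertices, with value `1` on non-adjacent pairs. -/
noncomputable def signFun (u w : V) : ℤˣ :=
  if h : S.graph.Adj u w then S.sign ⟨s(u, w), h⟩ else 1

theorem signFun_comm (u w : V) : signFun S u w = signFun S w u := by
  unfold signFun
  by_cases h : S.graph.Adj u w
  · rw [dif_pos h, dif_pos h.symm]
    congr 1
    exact Subtype.ext Sym2.eq_swap
  · rw [dif_neg h, dif_neg fun h' => h h'.symm]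

variable {S}

/-- The endpoint of the edge of an incidence other than its vertex. -/
noncomputable def otherEnd (i : S.Incidence) : V := Sym2.Mem.other i.mem

theorem mk_otherEnd (i : S.Incidence) : s(i.vertex, otherEnd i) = (i.edge : Sym2 V) :=
  Sym2.other_spec i.mem

theorem adj_otherEnd (i : S.Incidence) : S.graph.Adj i.vertex (otherEnd i) := by
  rw [← SimpleGraph.mem_edgeSet, mk_otherEnd]
  exact i.edge.2

theorem exists_zeroFree_coloring [Fintype V] [DecidableRel S.graph.Adj] {n k : ℕ} (hn : n = 2 * k)
    (hdeg : S.graph.maxDegree < n) : ∃ γ : S.Coloring n, γ.IsProper ∧ γ.IsZeroFree := by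
  obtain ⟨c, h, hfull⟩ := exists_isPartialColoring_forall_ne_zero (G := S.graph) (k := k)
    (signFun_comm S) (fun u => by have := S.graph.degree_le_maxDegree u; omega)
  refine ⟨⟨fun i => c i.vertex (otherEnd i), fun i => ⟨?_, fun h0 => ?_⟩, fun i j hij hne => ?_⟩,
    fun i j hij hne e => ?_, fun i => hfull _ _ (adj_otherEnd i)⟩
  · have hk : n / 2 = k := by omega
    rw [hk]
    exact h.bound _ _
  · exact absurd h0 (hfull _ _ (adj_otherEnd i))
  · have hi := mk_otherEnd i
    have hj := mk_otherEnd j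
    rw [← hij, ← hi, Sym2.eq_iff] at hj
    obtain ⟨h1, h2⟩ : j.vertex = otherEnd i ∧ otherEnd j = i.vertex := by
      rcases hj with hj | hj
      · exact absurd hj.1.symm hne
      · exact hj
    have hsign : signFun S j.vertex (otherEnd j) = S.sign i.edge := by
      rw [signFun, dif_pos (adj_otherEnd j)]
      congr 1
      exact Subtype.ext ((mk_otherEnd j).trans (congrArg Subtype.val hij.symm))
    have := h.compat j.vertex (otherEnd j)
    rw [hsign, h1, h2] at this
    simpa [h1, h2] using this
  · refine hne (Subtype.ext ?_)
    change c i.vertex (otherEnd i) = c j.vertex (otherEnd j) at e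
    rw [← hij] at e
    have := h.proper (hfull _ _ (adj_otherEnd i)) e
    rw [← mk_otherEnd i, ← mk_otherEnd j, this, hij]

theorem card_le_of_subset_signedColors {n : ℕ} {T : Finset ℤ} (hT : ∀ t ∈ T, t ∈ signedColors n) :
    T.card ≤ n := by
  by_cases hn : Odd n
  · have hsub : T ⊆ Finset.Icc (-((n / 2 : ℕ) : ℤ)) ((n / 2 : ℕ) : ℤ) := fun t ht =>
      Finset.mem_Icc.2 (abs_le.1 (hT t ht).1)
    have := Finset.card_le_card hsub
    rw [Int.card_Icc] at this
    obtain ⟨m, rfl⟩ := hn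
    omega
  · have hsub : T ⊆ (Finset.Icc (-((n / 2 : ℕ) : ℤ)) ((n / 2 : ℕ) : ℤ)).erase 0 := fun t ht =>
      Finset.mem_erase.2 ⟨fun h0 => hn ((hT t ht).2 h0), Finset.mem_Icc.2 (abs_le.1 (hT t ht).1)⟩
    have := Finset.card_le_card hsub
    rw [Finset.card_erase_of_mem (Finset.mem_Icc.2 ⟨by omega, by omega⟩), Int.card_Icc] at this
    obtain ⟨m, rfl⟩ := Nat.not_odd_iff_even.1 hn
    omega

/-- The colours at a vertex of maximum degree are distinct, so at least as many colours as the
maximum degree are needed. -/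
theorem maxDegree_le_of_isProper [Fintype V] [DecidableRel S.graph.Adj] {n : ℕ} {γ : S.Coloring n}
    (hγ : γ.IsProper) : S.graph.maxDegree ≤ n := by
  classical
  refine S.graph.maxDegree_le_of_forall_degree_le n fun v => ?_
  let f : S.graph.neighborSet v → ℤ := fun w =>
    γ.color ⟨v, ⟨s(v, w.1), w.2⟩, Sym2.mem_mk_left v w.1⟩
  have hf : Function.Injective f := by
    intro w w' e
    by_contra hne
    refine hγ ⟨v, ⟨s(v, w.1), w.2⟩, Sym2.mem_mk_left v w.1⟩
      ⟨v, ⟨s(v, w'.1), w'.2⟩, Sym2.mem_mk_left v w'.1⟩ rfl (fun e' => hne ?_) e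
    have e'' : s(v, w.1) = s(v, w'.1) := congrArg Subtype.val e'
    exact Subtype.ext (Sym2.congr_right.1 e'')
  rw [← S.graph.card_neighborSet_eq_degree, ← Finset.card_univ,
    ← Finset.card_image_of_injective _ hf]
  refine card_le_of_subset_signedColors fun t ht => ?_
  obtain ⟨w, -, rfl⟩ := Finset.mem_image.1 ht
  exact γ.color_mem _

theorem maxDegree_le_and_chromaticIndex_le [Fintype V] [DecidableRel S.graph.Adj] {n : ℕ}
    (h : ∃ γ : S.Coloring n, γ.IsProper ∧ γ.IsZeroFree) :
    S.graph.maxDegree ≤ S.chromaticIndex ∧ S.chromaticIndex ≤ n := by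
  obtain ⟨γ, hγ, -⟩ := h
  have hmem : n ∈ {n | ∃ γ : S.Coloring n, γ.IsProper} := ⟨γ, hγ⟩
  obtain ⟨γ', hγ'⟩ := Nat.sInf_mem ⟨n, hmem⟩
  exact ⟨maxDegree_le_of_isProper hγ', Nat.sInf_le hmem⟩

end SignedGraph

end SignedVizing

theorem mainTheorem2 {V : Type*} [Fintype V] (S : SignedGraph V) [DecidableRel S.graph.Adj] :
    (Odd S.graph.maxDegree →
      S.graph.maxDegree ≤ S.chromaticIndex ∧
      S.chromaticIndex ≤ S.graph.maxDegree + 1 ∧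
      ∃ γ : S.Coloring (S.graph.maxDegree + 1), γ.IsProper ∧ γ.IsZeroFree) ∧
    (Even S.graph.maxDegree →
      S.graph.maxDegree ≤ S.chromaticIndex ∧
      S.chromaticIndex ≤ S.graph.maxDegree + 2 ∧
      ∃ γ : S.Coloring (S.graph.maxDegree + 2), γ.IsProper ∧ γ.IsZeroFree) := by
  refine ⟨fun ⟨m, hm⟩ => ?_, fun ⟨m, hm⟩ => ?_⟩
  · have h := SignedVizing.exists_zeroFree_coloring (S := S) (n := S.graph.maxDegree + 1)
      (k := m + 1) (by omega) (by omega)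
    have h' := SignedVizing.maxDegree_le_and_chromaticIndex_le h
    exact ⟨h'.1, h'.2, h⟩
  · have h := SignedVizing.exists_zeroFree_coloring (S := S) (n := S.graph.maxDegree + 2)
      (k := m + 1) (by omega) (by omega)
    have h' := SignedVizing.maxDegree_le_and_chromaticIndex_le h
    exact ⟨h'.1, h'.2, h⟩
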